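/- Let $\mathbb{F}$ be an arbitrary field. Let $P_2$ be the (nonassociative) $\mathbb{F}$-algebra with linear basis $$a_{ij},\ b_{ij},\ c_i,\ d_{ij},\ e_{ij}\qquad (i,j\in\{1,2\})$$ and with the bilinear product defined on the basis by $$a_{ij}c_i=d_{ij},\qquad b_{ij}c_i=e_{ij},\qquad a_{ij}e_{ij}=e_{ij}a_{ij}=-b_{ij}d_{ij}=-d_{ij}b_{ij}=c_j,$$ all other products of basis elements being zero. Then $P_2$ is finite-dimensional and satisfies the following. 1. $P_2$ is metabelian, i.e. $(ab)(cd)=0$ for all $a,b,c,d\in P_2$. 2. $P_2$ is right-symmetric, i.e. $(a,b,c)=(a,c,b)$ for all $a,b,c\in P_2$, where $(a,b,c)=(ab)c-a(bc)$. 3. $P_2$ lies in the variety $\mathcal{R}$ of algebras defined by the identities $[[a,b],c]=0$, $(ab)a=0$ and $(ab)(cd)=0$, where $[x,y]=xy-yx$. 4. $P_2$ does not have a finite basis of identities: there is no finite set $S$ of elements of the free nonassociative $\mathbb{F}$-algebra $\mathbb{F}\langle X\rangle$ on $X=\{x_1,x_2,\dots\}$ such that the smallest two-sided ideal of $\mathbb{F}\langle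 X\rangle$ that contains $S$ and is stable under all endomorphisms of $\mathbb{F}\langle X\rangle$ equals the set of all identities of $P_2$ (the elements of $\mathbb{F}\langle X\rangle$ that vanish under every substitution of elements of $P_2$ for the variables). -/

import Mathlib

noncomputable section

/-! ### Polynomial identities of nonassociative algebras -/

section Identities

variable (F : Type*) [Field F]

/-- The free nonassociative (nonunital) algebra on countably many variables `x₀, x₁, x₂, …`. -/
abbrev NonassocPoly : Type _ := FreeNonUnitalNonAssocAlgebra F ℕ

/-- A T-ideal: a two-sided ideal of the free nonassociative algebra which is stable under all
algebra endomorphisms, that is, under all substitutions of polynomials for the variables. -/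
structure IsTIdeal (I : Submodule F (NonassocPoly F)) : Prop where
  mul_mem_left : ∀ g f : NonassocPoly F, f ∈ I → g * f ∈ I
  mul_mem_right : ∀ f g : NonassocPoly F, f ∈ I → f * g ∈ I
  map_mem : ∀ (φ : NonassocPoly F →ₙₐ[F] NonassocPoly F) (f : NonassocPoly F), f ∈ I → φ f ∈ I

/-- The smallest T-ideal containing `S`: the polynomials `f` such that `f = 0` is a consequence of
the identities `s = 0`, `s ∈ S`. -/
def tIdealSpan (S : Set (NonassocPoly F)) : Submodule F (NonassocPoly F) :=
  sInf {I | IsTIdeal F I ∧ S ⊆ (I : Set (NonassocPoly F))}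

variable (A : Type*) [NonUnitalNonAssocRing A] [Module F A] [IsScalarTower F A A]
  [SMulCommClass F A A]

/-- The polynomials `f` such that `f = 0` is an identity of the algebra `A`, i.e. `f` vanishes
under every substitution of elements of `A` for the variables. -/
def identities : Set (NonassocPoly F) :=
  {f | ∀ x : ℕ → A, FreeNonUnitalNonAssocAlgebra.lift F x f = 0}

/-- `A` has a finite basis of identities: finitely many identities of `A` have all
identities of `A` as consequences. -/
def HasFiniteBasisOfIdentities : Prop :=
  ∃ S : Set (NonassocPoly F), S.Finite ∧
    (tIdealSpan F S : Set (NonassocPoly F)) = identities F A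

end Identities

/-! ### Classes of nonassociative algebras -/

section Classes

variable (A : Type*) [NonUnitalNonAssocRing A]

/-- `(a, b, c) = (a, c, b)`, where `(a, b, c) = (a b) c - a (b c)`. -/
def IsRightSymmetric : Prop :=
  ∀ a b c : A, associator a b c = associator a c b

/-- `A² A² = 0`. -/
def IsMetabelianAlg : Prop :=
  ∀ a b c d : A, (a * b) * (c * d) = 0

/-- The variety defined by `[[a, b], c] = 0`, `(a b) a = 0` and `(a b) (c d) = 0`. -/
structure InVarietyR : Prop where
  comm_comm : ∀ a b c : A, (a * b - b * a) * c - c * (a * b - b * a) = 0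
  mul_mul_self : ∀ a b : A, (a * b) * a = 0
  mul_mul_mul : ∀ a b c d : A, (a * b) * (c * d) = 0

end Classes

/-! ### The algebras `P_n` -/

/-- Labels of the basis elements `a_ij, b_ij, c_i, d_ij, e_ij` of `P_n`. -/
inductive PIndex (n : ℕ) : Type
  | a (i j : Fin n)
  | b (i j : Fin n)
  | c (i : Fin n)
  | d (i j : Fin n)
  | e (i j : Fin n)
  deriving DecidableEq, Fintype

/-- The vector space over `F` with basis `a_ij, b_ij, c_i, d_ij, e_ij`, `i, j ∈ {1, …, n}`
(coordinate vectors). -/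
def PAlg (F : Type*) (n : ℕ) : Type _ := PIndex n → F

namespace PAlg

variable {F : Type*} [Field F] {n : ℕ}

instance : AddCommGroup (PAlg F n) := inferInstanceAs (AddCommGroup (PIndex n → F))

instance : Module F (PAlg F n) := inferInstanceAs (Module F (PIndex n → F))

/-- The basis element with the given label. -/
def basisVec (p : PIndex n) : PAlg F n := Pi.single p (1 : F)

/-- The multiplication table: `a_ij c_i = d_ij`, `b_ij c_i = e_ij`,
`a_ij e_ij = e_ij a_ij = - b_ij d_ij = - d_ij b_ij = c_j`; all other products are zero. -/
def basisMul : PIndex n → PIndex n → PAlg F n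
  | .a i j, .c k => if i = k then basisVec (.d i j) else 0
  | .b i j, .c k => if i = k then basisVec (.e i j) else 0
  | .a i j, .e k l => if i = k ∧ j = l then basisVec (.c j) else 0
  | .e i j, .a k l => if i = k ∧ j = l then basisVec (.c j) else 0
  | .b i j, .d k l => if i = k ∧ j = l then -basisVec (.c j) else 0
  | .d i j, .b k l => if i = k ∧ j = l then -basisVec (.c j) else 0
  | _, _ => 0

/-- The bilinear extension of the multiplication table. -/
instance : Mul (PAlg F n) :=
  ⟨fun x y => ∑ p : PIndex n, ∑ q : PIndex n, (x p * y q) • (basisMul p q : PAlg F n)⟩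

theorem mul_def (x y : PAlg F n) :
    x * y = ∑ p : PIndex n, ∑ q : PIndex n, (x p * y q) • (basisMul p q : PAlg F n) := rfl

theorem add_apply (x y : PAlg F n) (p : PIndex n) : (x + y) p = x p + y p := rfl

theorem neg_apply (x : PAlg F n) (p : PIndex n) : (-x) p = -x p := rfl

theorem basisVec_apply (p q : PIndex n) :
    (basisVec p : PAlg F n) q = if q = p then 1 else 0 := Pi.single_apply p 1 q

theorem zero_apply (p : PIndex n) : (0 : PAlg F n) p = 0 := rfl

theorem smul_apply (r : F) (x : PAlg F n) (p : PIndex n) : (r • x) p = r * x p := rfl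

instance : NonUnitalNonAssocRing (PAlg F n) where
  left_distrib x y z := by
    simp only [mul_def, add_apply, mul_add, add_smul, Finset.sum_add_distrib]
  right_distrib x y z := by
    simp only [mul_def, add_apply, add_mul, add_smul, Finset.sum_add_distrib]
  zero_mul x := by simp [mul_def, zero_apply]
  mul_zero x := by simp [mul_def, zero_apply]

instance : IsScalarTower F (PAlg F n) (PAlg F n) where
  smul_assoc r x y := by
    simp only [smul_eq_mul, mul_def, smul_apply, Finset.smul_sum, smul_smul, mul_assoc]

instance : SMulCommClass F (PAlg F n) (PAlg F n) where
  smul_comm r x y := by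
    simp only [smul_eq_mul, mul_def, smul_apply, Finset.smul_sum, smul_smul, mul_left_comm]

/-- On basis elements the product is given by the table. -/
theorem basisVec_mul_basisVec (p q : PIndex n) :
    (basisVec p * basisVec q : PAlg F n) = basisMul p q := by
  rw [mul_def, Finset.sum_eq_single p, Finset.sum_eq_single q]
  · simp [basisVec]
  · intro q' _ h
    simp [basisVec, Pi.single_eq_of_ne h]
  · simp
  · intro p' _ h
    simp [basisVec, Pi.single_eq_of_ne h]
  · simp

end PAlg

end

/-!
The only nontrivial part is the absence of a finite basis of identities.

Let `V` be the span of the `a_ij, b_ij` and `I` the span of the `c_i, d_ij, e_ij` in `P_n`; then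
`V * V = I * I = 0`. For `x, y` in `P_n` the operator `p ↦ [y, p] x` preserves the span of the
`c_i` and acts there by the `n × n` matrix with entries `b_ij(y) a_ij(x) - a_ij(y) b_ij(x)`
(`PAlg.commOp_cVec`). For `n = 2` these matrices satisfy Hall's identity
`[[A, B] ∘ [C, D], Z] = 0`. Taking for `C` a product of `N` such operators in distinct variables
gives a polynomial `hallPoly F N` which is an identity of `P_2`. It is shown that the identities of
`P_2` of degree less than `N` do not imply it.

For this, think of `P_3` as a quiver with vertices `0, 1, 2` and of its products as paths. Keep the
edges `0 → 1 → 2` and the three loops only. Forgetting the vertex `2`, or the vertex `0`, leads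
back to `P_2`, so an identity of `P_2` can only fail on paths from `0` to `2`. To repair this for
identities of small degree, take functions from the cube `{0, 1}^N` to this subalgebra of `P_3`
in which the loop at `1` has coefficients of degree at most `1` on the cube and the other edges
have constant coefficients (`PAlg.pathAlgebra`), and identify functions ending at `2` which
have the same top difference `∑ ω, (-1) ^ |ω| h(ω)` (`PAlg.pathIdeal`). On paths from `0` to `2` a
polynomial of degree `D < N` produces functions of degree at most `D` on the cube, and these have
zero top difference (`topDiff_eq_zero`, `PAlg.mem_relativeIdentities`). In `hallPoly F N`, on the
other hand, the loop at `1` can be passed `N` times with the `N` different coordinates as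
coefficients; their product is the indicator function of one vertex of the cube, and its top
difference is `± 1` (`PAlg.hallPoly_notMem_relativeIdentities`). Working with values of
functions on the cube instead of formal variables makes the argument independent of the field: over
a finite field the identities of `P_2` need not be homogeneous.
-/

noncomputable section

/-! ### Substitutions into nonassociative polynomials -/

section Substitution

open FreeNonUnitalNonAssocAlgebra

variable {F : Type*} [Field F]

/-- Induction on the free nonassociative algebra: a property which holds for the variables and
is preserved by linear combinations and products holds for all polynomials. -/
theorem NonassocPoly.induction {P : NonassocPoly F → Prop} (zero : P 0)
    (of : ∀ i, P (of F i)) (add : ∀ f g, P f → P g → P (f + g))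
    (smul : ∀ (r : F) f, P f → P (r • f)) (mul : ∀ f g, P f → P g → P (f * g))
    (f : NonassocPoly F) : P f := by
  let T : NonUnitalSubalgebra F (NonassocPoly F) :=
    { carrier := {f | P f}
      zero_mem' := zero
      add_mem' := fun {f g} hf hg => add f g hf hg
      smul_mem' := fun r {f} hf => smul r f hf
      mul_mem' := fun {f g} hf hg => mul f g hf hg }
  let φ : NonassocPoly F →ₙₐ[F] T := lift F fun i => ⟨FreeNonUnitalNonAssocAlgebra.of F i, of i⟩
  have h : (NonUnitalSubalgebraClass.subtype T).comp φ = NonUnitalAlgHom.id F _ := by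
    refine hom_ext (R := F) fun i => ?_
    simp [φ]
  have := (φ f).2
  rwa [show ((φ f : T) : NonassocPoly F) = f from DFunLike.congr_fun h f] at this

variable {A : Type*} [NonUnitalNonAssocRing A] [Module F A] [IsScalarTower F A A]
  [SMulCommClass F A A]
  {A' : Type*} [NonUnitalNonAssocRing A'] [Module F A'] [IsScalarTower F A' A']
  [SMulCommClass F A' A']

theorem lift_mem (B : NonUnitalSubalgebra F A) {x : ℕ → A} (hx : ∀ i, x i ∈ B)
    (f : NonassocPoly F) : lift F x f ∈ B := by
  induction f using NonassocPoly.induction with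
  | zero => simp
  | of i => simpa using hx i
  | add f g hf hg => rw [map_add]; exact add_mem hf hg
  | smul r f hf => rw [map_smul]; exact SMulMemClass.smul_mem r hf
  | mul f g hf hg => rw [map_mul]; exact mul_mem hf hg

/-- Evaluation of polynomials commutes with a linear map which is multiplicative only on a
subalgebra, provided the values of the variables lie in that subalgebra. -/
theorem map_lift_of_mulOn (B : NonUnitalSubalgebra F A) (φ : A →ₗ[F] A')
    (hφ : ∀ x ∈ B, ∀ y ∈ B, φ (x * y) = φ x * φ y) {x : ℕ → A} (hx : ∀ i, x i ∈ B)
    (f : NonassocPoly F) : φ (lift F x f) = lift F (fun i => φ (x i)) f := by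
  induction f using NonassocPoly.induction with
  | zero => simp
  | of i => simp
  | add f g hf hg => simp [hf, hg]
  | smul r f hf => simp [hf]
  | mul f g hf hg =>
    rw [map_mul (lift F x), map_mul (lift F _), hφ _ (lift_mem B hx f) _ (lift_mem B hx g), hf, hg]

/-- If `J` is a subspace of `A` stable under multiplication by the subalgebra `B`, then the
polynomials all of whose values on `B` lie in `J` form a T-ideal: they are the identities of the
quotient of `B` by its ideal `B ⊓ J`. -/
def relativeIdentities (B : NonUnitalSubalgebra F A) (J : Submodule F A) :
    Submodule F (NonassocPoly F) where
  carrier := {f | ∀ x : ℕ → A, (∀ i, x i ∈ B) → lift F x f ∈ J}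
  zero_mem' := fun x _ => by simp
  add_mem' := fun hf hg x hx => by rw [map_add]; exact add_mem (hf x hx) (hg x hx)
  smul_mem' := fun r f hf x hx => by rw [map_smul]; exact J.smul_mem r (hf x hx)

theorem isTIdeal_relativeIdentities (B : NonUnitalSubalgebra F A) (J : Submodule F A)
    (hl : ∀ b ∈ B, ∀ j ∈ J, b * j ∈ J) (hr : ∀ b ∈ B, ∀ j ∈ J, j * b ∈ J) :
    IsTIdeal F (relativeIdentities B J) where
  mul_mem_left g f hf x hx := by
    rw [map_mul]; exact hl _ (lift_mem B hx g) _ (hf x hx)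
  mul_mem_right f g hf x hx := by
    rw [map_mul]; exact hr _ (lift_mem B hx g) _ (hf x hx)
  map_mem φ f hf x hx := by
    have h : (lift F x) (φ f) = lift F (fun i => lift F x (φ (of F i))) f := by
      have : (lift F x).comp φ = lift F (fun i => lift F x (φ (of F i))) := by
        refine hom_ext (R := F) fun i => ?_
        simp
      exact DFunLike.congr_fun this f
    rw [h]
    exact hf _ fun i => lift_mem B hx _

/-- Polynomials are affine along directions `u`, `w` in which products vanish: if `I` contains all
products and `I * I = 0`, then the mixed second difference of `f` along `I` is zero. -/
theorem lift_add_add (I : Submodule F A) (hI : ∀ x y : A, x * y ∈ I)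
    (hII : ∀ x ∈ I, ∀ y ∈ I, x * y = 0) (v u w : ℕ → A) (hu : ∀ i, u i ∈ I) (hw : ∀ i, w i ∈ I)
    (f : NonassocPoly F) :
    lift F (v + u + w) f = lift F (v + u) f + lift F (v + w) f - lift F v f := by
  suffices h : ∃ a ∈ I, ∃ b ∈ I, lift F (v + u) f = lift F v f + a ∧
      lift F (v + w) f = lift F v f + b ∧ lift F (v + u + w) f = lift F v f + a + b by
    obtain ⟨a, -, b, -, h₁, h₂, h₃⟩ := h
    rw [h₁, h₂, h₃]
    abel
  induction f using NonassocPoly.induction with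
  | zero => exact ⟨0, I.zero_mem, 0, I.zero_mem, by simp⟩
  | of i => exact ⟨u i, hu i, w i, hw i, by simp⟩
  | add f g hf hg =>
    obtain ⟨a, ha, b, hb, h₁, h₂, h₃⟩ := hf
    obtain ⟨a', ha', b', hb', h₁', h₂', h₃'⟩ := hg
    refine ⟨a + a', I.add_mem ha ha', b + b', I.add_mem hb hb', ?_, ?_, ?_⟩ <;>
      simp only [map_add, h₁, h₂, h₃, h₁', h₂', h₃'] <;> abel
  | smul r f hf =>
    obtain ⟨a, ha, b, hb, h₁, h₂, h₃⟩ := hf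
    exact ⟨r • a, I.smul_mem r ha, r • b, I.smul_mem r hb, by simp [h₁, h₂, h₃]⟩
  | mul f g hf hg =>
    obtain ⟨a, ha, b, hb, h₁, h₂, h₃⟩ := hf
    obtain ⟨a', ha', b', hb', h₁', h₂', h₃'⟩ := hg
    refine ⟨a * lift F v g + lift F v f * a', I.add_mem (hI _ _) (hI _ _),
      b * lift F v g + lift F v f * b', I.add_mem (hI _ _) (hI _ _), ?_, ?_, ?_⟩ <;>
      simp only [map_mul, h₁, h₂, h₃, h₁', h₂', h₃', mul_add, add_mul, hII _ ha _ ha',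
        hII _ ha _ hb', hII _ hb _ ha', hII _ hb _ hb'] <;> abel

end Substitution

/-! ### Coordinates of products in `P_n` -/

namespace PAlg

variable {F : Type*} [Field F] {n : ℕ}

@[ext]
theorem ext {F : Type*} {x y : PAlg F n} (h : ∀ p, x p = y p) : x = y := funext h

@[simp] theorem zero_coord (p : PIndex n) : (0 : PAlg F n) p = 0 := rfl
@[simp] theorem add_coord (x y : PAlg F n) (p : PIndex n) : (x + y) p = x p + y p := rfl
@[simp] theorem neg_coord (x : PAlg F n) (p : PIndex n) : (-x) p = -x p := rfl
@[simp] theorem sub_coord (x y : PAlg F n) (p : PIndex n) : (x - y) p = x p - y p := rfl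
@[simp] theorem smul_coord (r : F) (x : PAlg F n) (p : PIndex n) : (r • x) p = r * x p := rfl

/-- The labels of `P_n`, sorted by their letter. -/
def labelEquiv (n : ℕ) : PIndex n ≃
    (((Fin n × Fin n) ⊕ (Fin n × Fin n)) ⊕ Fin n) ⊕ ((Fin n × Fin n) ⊕ (Fin n × Fin n)) where
  toFun
    | .a i j => .inl (.inl (.inl (i, j)))
    | .b i j => .inl (.inl (.inr (i, j)))
    | .c i => .inl (.inr i)
    | .d i j => .inr (.inl (i, j))
    | .e i j => .inr (.inr (i, j))
  invFun
    | .inl (.inl (.inl (i, j))) => .a i j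
    | .inl (.inl (.inr (i, j))) => .b i j
    | .inl (.inr i) => .c i
    | .inr (.inl (i, j)) => .d i j
    | .inr (.inr (i, j)) => .e i j
  left_inv p := by cases p <;> rfl
  right_inv p := by rcases p with ((⟨i, j⟩ | ⟨i, j⟩) | i) | (⟨i, j⟩ | ⟨i, j⟩) <;> rfl

theorem sum_labels {M : Type*} [AddCommMonoid M] (f : PIndex n → M) :
    ∑ p, f p = ((∑ i, ∑ j, f (.a i j) + ∑ i, ∑ j, f (.b i j)) + ∑ i, f (.c i)) +
      (∑ i, ∑ j, f (.d i j) + ∑ i, ∑ j, f (.e i j)) := by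
  rw [← (labelEquiv n).symm.sum_comp f]
  simp only [Fintype.sum_sum_type, Fintype.sum_prod_type]
  rfl

theorem ite_coord {F : Type*} (P : Prop) [Decidable P] (x y : PAlg F n) (p : PIndex n) :
    (if P then x else y) p = if P then x p else y p := by split_ifs <;> rfl

theorem mul_coord (x y : PAlg F n) (r : PIndex n) :
    (x * y) r = ∑ p, ∑ q, x p * y q * (basisMul p q : PAlg F n) r := by
  let ev : PAlg F n →+ F := ⟨⟨fun z => z r, rfl⟩, fun _ _ => rfl⟩
  change ev (x * y) = _
  simp only [mul_def, map_sum]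
  rfl

@[simp] theorem mul_a (x y : PAlg F n) (i j : Fin n) : (x * y) (.a i j) = 0 := by
  simp only [mul_coord, sum_labels, basisMul]
  simp [basisVec_apply, ite_coord]

@[simp] theorem mul_b (x y : PAlg F n) (i j : Fin n) : (x * y) (.b i j) = 0 := by
  simp only [mul_coord, sum_labels, basisMul]
  simp [basisVec_apply, ite_coord]

theorem mul_d (x y : PAlg F n) (i j : Fin n) : (x * y) (.d i j) = x (.a i j) * y (.c i) := by
  simp only [mul_coord, sum_labels, basisMul]
  simp [basisVec_apply, ite_coord, ite_and]

theorem mul_e (x y : PAlg F n) (i j : Fin n) : (x * y) (.e i j) = x (.b i j) * y (.c i) := by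
  simp only [mul_coord, sum_labels, basisMul]
  simp [basisVec_apply, ite_coord, ite_and]

theorem mul_c (x y : PAlg F n) (j : Fin n) : (x * y) (.c j) =
    ∑ i, (x (.a i j) * y (.e i j) + x (.e i j) * y (.a i j)
      - x (.b i j) * y (.d i j) - x (.d i j) * y (.b i j)) := by
  simp only [mul_coord, sum_labels, basisMul]
  simp [basisVec_apply, ite_coord, ite_and, Finset.sum_add_distrib,
    Finset.sum_sub_distrib]
  ring

end PAlg

/-! ### The identities defining the varieties -/

namespace PAlg

variable {F : Type*} [Field F] {n : ℕ}

theorem mul_c_comm (x y : PAlg F n) (j : Fin n) : (x * y) (.c j) = (y * x) (.c j) := by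
  rw [mul_c, mul_c]
  exact Finset.sum_congr rfl fun i _ => by ring

theorem isMetabelianAlg : IsMetabelianAlg (PAlg F n) := by
  intro x y z t
  ext p
  cases p <;> simp [mul_c, mul_d, mul_e]

theorem isRightSymmetric : IsRightSymmetric (PAlg F n) := by
  intro x y z
  ext p
  cases p with
  | a i j => simp [associator]
  | b i j => simp [associator]
  | c j =>
    simp only [associator, sub_coord, mul_c, mul_d, mul_e, mul_a, mul_b,
      ← Finset.sum_sub_distrib]
    exact Finset.sum_congr rfl fun i _ => by ring
  | d i j => simp [associator, mul_d, mul_c_comm y z]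
  | e i j => simp [associator, mul_e, mul_c_comm y z]

theorem inVarietyR : InVarietyR (PAlg F n) where
  comm_comm x y z := by
    ext p
    cases p with
    | a i j => simp
    | b i j => simp
    | c j => simp [mul_c_comm z]
    | d i j => simp [mul_d, mul_c_comm y x]
    | e i j => simp [mul_e, mul_c_comm y x]
  mul_mul_self x y := by
    ext p
    cases p with
    | c j =>
      rw [mul_c]
      refine Finset.sum_eq_zero fun i _ => ?_
      simp only [mul_a, mul_b, mul_d, mul_e]
      ring
    | _ => simp [mul_d, mul_e]
  mul_mul_mul := isMetabelianAlg

end PAlg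

/-! ### Hall's identity for commutator operators -/

/-- Hall's polynomial `[[A, B] ∘ [C, D], Z]`, where `u ∘ v = u v + v u`; it vanishes on `2 × 2`
matrices because `[A, B] ∘ [C, D]` is scalar there. -/
def hall {R : Type*} [Ring R] (A B C D Z : R) : R :=
  ((A * B - B * A) * (C * D - D * C) + (C * D - D * C) * (A * B - B * A)) * Z -
    Z * ((A * B - B * A) * (C * D - D * C) + (C * D - D * C) * (A * B - B * A))

theorem hall_matrix_fin_two {R : Type*} [CommRing R] (A B C D Z : Matrix (Fin 2) (Fin 2) R) :
    hall A B C D Z = 0 := by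
  ext i j
  fin_cases i <;> fin_cases j <;>
    simp only [hall, Matrix.sub_apply, Matrix.add_apply, Matrix.mul_apply, Fin.sum_univ_two,
      Fin.zero_eta, Fin.mk_one, Matrix.zero_apply] <;> ring

section Intertwining

variable {F : Type*} [Field F] {E E' : Type*} [AddCommGroup E] [Module F E] [AddCommGroup E']
  [Module F E'] {φ : E →ₗ[F] E'}

theorem hall_intertwine {A B C D Z : Module.End F E} {A' B' C' D' Z' : Module.End F E'}
    (hA : ∀ p, φ (A p) = A' (φ p)) (hB : ∀ p, φ (B p) = B' (φ p)) (hC : ∀ p, φ (C p) = C' (φ p))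
    (hD : ∀ p, φ (D p) = D' (φ p)) (hZ : ∀ p, φ (Z p) = Z' (φ p)) (p : E) :
    φ (hall A B C D Z p) = hall A' B' C' D' Z' (φ p) := by
  simp [hall, hA, hB, hC, hD, hZ]

theorem list_prod_intertwine {ι : Type*} {T : ι → Module.End F E} {T' : ι → Module.End F E'}
    (h : ∀ s p, φ (T s p) = T' s (φ p)) (l : List ι) (p : E) :
    φ ((l.map T).prod p) = (l.map T').prod (φ p) := by
  induction l with
  | nil => simp
  | cons s l ih => simp [h, ih]

end Intertwining

section TestPolynomial

open FreeNonUnitalNonAssocAlgebra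

variable (F : Type*) [Field F]
variable {A : Type*} [NonUnitalNonAssocRing A] [Module F A] [IsScalarTower F A A]
  [SMulCommClass F A A]

/-- The operator `p ↦ [y, p] x`. -/
def commOp (y x : A) : Module.End F A :=
  LinearMap.mulRight F x ∘ₗ (LinearMap.mulLeft F y - LinearMap.mulRight F y)

variable {F} in
theorem commOp_apply (y x p : A) : commOp F y x p = (y * p - p * y) * x := rfl

/-- The value at the point `x` of the polynomials `hallPoly F N`. Writing `T i` for the operator
`p ↦ [x 0, p] (x i)`, it is Hall's polynomial in `T 2`, `T 3`, `T 6 ⋯ T (N + 5)`, `T 4`, `T 5`,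
applied to the vector `(x 0 * x 1) * x 5`. -/
def hallValue (N : ℕ) (x : ℕ → A) : A :=
  hall (commOp F (x 0) (x 2)) (commOp F (x 0) (x 3))
    ((List.finRange N).map fun s : Fin N => commOp F (x 0) (x (s.val + 6))).prod
    (commOp F (x 0) (x 4)) (commOp F (x 0) (x 5)) ((x 0 * x 1) * x 5)

/-- Hall's identity with one entry a product of `N` operators, as a nonassociative polynomial. -/
def hallPoly (N : ℕ) : NonassocPoly F := hallValue F N (of F)

theorem lift_hallPoly (N : ℕ) (x : ℕ → A) : lift F x (hallPoly F N) = hallValue F N x := by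
  have h (i j : ℕ) (p : NonassocPoly F) :
      ((lift F x : NonassocPoly F →ₙₐ[F] A) : NonassocPoly F →ₗ[F] A)
        (commOp F (of F i) (of F j) p) =
      commOp F (x i) (x j) (((lift F x : NonassocPoly F →ₙₐ[F] A) : NonassocPoly F →ₗ[F] A) p) := by
    have hi (k : ℕ) : lift F x (of F k) = x k := lift_of_apply ..
    simp [commOp_apply, hi]
  refine (hall_intertwine (h 0 2) (h 0 3)
    (list_prod_intertwine (fun s : Fin N => h 0 (s.val + 6)) (List.finRange N)) (h 0 4) (h 0 5)
    ((of F 0 * of F 1) * of F 5)).trans ?_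
  have hi (k : ℕ) : lift F x (of F k) = x k := lift_of_apply ..
  simp [hallValue, hi]

end TestPolynomial

namespace PAlg

variable {F : Type*} [Field F] {n : ℕ}

/-- The vector `∑ i, γ i • c_i`, linearly in `γ`. -/
def cVec : (Fin n → F) →ₗ[F] PAlg F n where
  toFun γ := fun p => match p with
    | .c i => γ i
    | _ => 0
  map_add' γ δ := by ext p; cases p <;> first | rfl | exact (add_zero (0 : F)).symm
  map_smul' r γ := by ext p; cases p <;> first | rfl | exact (mul_zero r).symm

@[simp] theorem cVec_a (γ : Fin n → F) (i j : Fin n) : cVec γ (.a i j) = 0 := rfl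
@[simp] theorem cVec_b (γ : Fin n → F) (i j : Fin n) : cVec γ (.b i j) = 0 := rfl
@[simp] theorem cVec_c (γ : Fin n → F) (i : Fin n) : cVec γ (.c i) = γ i := rfl
@[simp] theorem cVec_d (γ : Fin n → F) (i j : Fin n) : cVec γ (.d i j) = 0 := rfl
@[simp] theorem cVec_e (γ : Fin n → F) (i j : Fin n) : cVec γ (.e i j) = 0 := rfl

/-- The matrix of `p ↦ [y, p] x` on the span of the `c_i`. Its entry for `c_i ↦ c_j` is the
determinant formed by the `a_ij`- and `b_ij`-coordinates of `x` and `y`. -/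
def commMatrix (y x : PAlg F n) : Matrix (Fin n) (Fin n) F :=
  Matrix.of fun j i => y (.b i j) * x (.a i j) - y (.a i j) * x (.b i j)

theorem commOp_cVec (y x : PAlg F n) (γ : Fin n → F) :
    cVec ((commMatrix y x).toLin' γ) = commOp F y x (cVec γ) := by
  ext p
  cases p with
  | c j =>
    simp only [cVec_c, commOp_apply, mul_c, mul_a, mul_b, mul_d, mul_e, sub_coord, cVec_a, cVec_b,
      Matrix.toLin'_apply, Matrix.mulVec, dotProduct, commMatrix, Matrix.of_apply]
    exact Finset.sum_congr rfl fun i _ => by ring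
  | _ => simp [commOp_apply, mul_d, mul_e]

theorem mul_mul_eq_cVec (x y z : PAlg F n) :
    (x * y) * z = cVec fun j => ((x * y) * z) (.c j) := by
  ext p
  cases p <;> simp [mul_d, mul_e]

/-- The polynomials `hallPoly` act on the span of the `c_i` through Hall's polynomial of `n × n`
matrices. -/
theorem hallValue_eq (N : ℕ) (x : ℕ → PAlg F n) :
    hallValue F N x = cVec ((hall (commMatrix (x 0) (x 2)) (commMatrix (x 0) (x 3))
      ((List.finRange N).map fun s : Fin N => commMatrix (x 0) (x (s.val + 6))).prod
      (commMatrix (x 0) (x 4)) (commMatrix (x 0) (x 5))).mulVec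
        fun j => ((x 0 * x 1) * x 5) (.c j)) := by
  have h (j : ℕ) := commOp_cVec (x 0) (x j)
  conv_lhs => rw [hallValue, mul_mul_eq_cVec]
  rw [← hall_intertwine (h 2) (h 3)
    (list_prod_intertwine (fun s : Fin N => h (s.val + 6)) (List.finRange N)) (h 4) (h 5)]
  have hl : ((List.finRange N).map fun s : Fin N => (commMatrix (x 0) (x (s.val + 6))).toLin').prod =
      (((List.finRange N).map fun s : Fin N => commMatrix (x 0) (x (s.val + 6))).prod).toLin' := by
    induction List.finRange N with
    | nil => simp [Module.End.one_eq_id]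
    | cons s l ih => simp [ih, Matrix.toLin'_mul, Module.End.mul_eq_comp]
  rw [hl, ← Matrix.toLin'_apply]
  simp only [hall, map_sub, map_add, Matrix.toLin'_mul, Module.End.mul_eq_comp]

theorem hallPoly_mem_identities (N : ℕ) : hallPoly F N ∈ identities F (PAlg F 2) := by
  intro x
  rw [lift_hallPoly, hallValue_eq, hall_matrix_fin_two]
  simp

end PAlg

/-! ### Functions of bounded degree on the discrete cube -/

section Cube

variable (F : Type*) [Field F] {N : ℕ}

/-- Functions on the cube `{0, 1}^N`, whose points are the subsets `ω` of `Fin N`, given by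
polynomials of degree at most `n` in the coordinates `ω ↦ [k ∈ ω]`: they are spanned by the
monomials `ω ↦ [s ⊆ ω]` with `s.card ≤ n`. -/
def degreeLE (N n : ℕ) : Submodule F (Finset (Fin N) → F) :=
  Submodule.span F {h | ∃ s : Finset (Fin N), s.card ≤ n ∧ h = fun ω => if s ⊆ ω then 1 else 0}

variable {F}

theorem degreeLE_mono {m n : ℕ} (h : m ≤ n) : degreeLE F N m ≤ degreeLE F N n :=
  Submodule.span_mono fun _ ⟨s, hs, e⟩ => ⟨s, hs.trans h, e⟩

theorem mul_mem_degreeLE {m n : ℕ} {f g : Finset (Fin N) → F} (hf : f ∈ degreeLE F N m)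
    (hg : g ∈ degreeLE F N n) : f * g ∈ degreeLE F N (m + n) := by
  have h := Submodule.mul_mem_mul hf hg
  rw [degreeLE, degreeLE, Submodule.span_mul_span] at h
  refine Submodule.span_mono ?_ h
  rintro _ ⟨_, ⟨s, hs, rfl⟩, _, ⟨t, ht, rfl⟩, rfl⟩
  refine ⟨s ∪ t, (Finset.card_union_le s t).trans (by omega), ?_⟩
  ext ω
  simp [Finset.union_subset_iff, ← ite_and, and_comm]

theorem mem_degreeLE_zero {f : Finset (Fin N) → F} :
    f ∈ degreeLE F N 0 ↔ ∃ r : F, f = fun _ => r := by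
  have : {h : Finset (Fin N) → F | ∃ s : Finset (Fin N), s.card ≤ 0 ∧
      h = fun ω => if s ⊆ ω then 1 else 0} = {1} := by
    ext h
    simp only [Nat.le_zero, Finset.card_eq_zero, Set.mem_ofPred_eq, exists_eq_left,
      Finset.empty_subset, if_true, Set.mem_singleton_iff]
    rfl
  rw [degreeLE, this, Submodule.mem_span_singleton]
  refine exists_congr fun r => ?_
  rw [eq_comm, show (r • 1 : Finset (Fin N) → F) = fun _ => r by ext; simp]

theorem const_mem_degreeLE (r : F) (n : ℕ) : (fun _ => r) ∈ degreeLE F N n :=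
  degreeLE_mono (Nat.zero_le n) (mem_degreeLE_zero.2 ⟨r, rfl⟩)

variable (F N) in
/-- The top difference `h ↦ ∑ ω, (-1) ^ |ω| h(ω)`. -/
def topDiff : (Finset (Fin N) → F) →ₗ[F] F :=
  ∑ ω : Finset (Fin N), (-1 : F) ^ ω.card • LinearMap.proj ω

theorem topDiff_apply (h : Finset (Fin N) → F) :
    topDiff F N h = ∑ ω : Finset (Fin N), (-1 : F) ^ ω.card * h ω := by
  simp [topDiff]

theorem topDiff_const_mul {f : Finset (Fin N) → F} (hf : f ∈ degreeLE F N 0)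
    {h : Finset (Fin N) → F} (hh : topDiff F N h = 0) : topDiff F N (f * h) = 0 := by
  obtain ⟨r, rfl⟩ := mem_degreeLE_zero.1 hf
  rw [show (fun _ => r) * h = r • h by ext; simp, map_smul, hh, smul_zero]

theorem topDiff_eq_zero {n : ℕ} (hn : n < N) {h : Finset (Fin N) → F}
    (hh : h ∈ degreeLE F N n) : topDiff F N h = 0 := by
  suffices H : degreeLE F N n ≤ LinearMap.ker (topDiff F N) from H hh
  rw [degreeLE, Submodule.span_le]
  rintro _ ⟨s, hs, rfl⟩
  obtain ⟨k, hk⟩ : ∃ k, k ∉ s := by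
    by_contra! H
    rw [Finset.eq_univ_iff_forall.2 H, Finset.card_univ, Fintype.card_fin] at hs
    omega
  rw [SetLike.mem_coe, LinearMap.mem_ker, topDiff_apply]
  -- Adding or removing `k ∉ s` does not change `[s ⊆ ω]`, but it changes the sign.
  refine Finset.sum_involution (fun ω _ => symmDiff ω {k}) ?_ ?_ (by simp) (by simp)
  · intro ω _
    have h₁ : s ⊆ symmDiff ω {k} ↔ s ⊆ ω := by
      simp only [Finset.subset_iff, Finset.mem_symmDiff, Finset.mem_singleton]
      refine forall₂_congr fun a ha => ?_
      have : a ≠ k := fun h => hk (h ▸ ha)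
      simp [this]
    have h₂ : (-1 : F) ^ (symmDiff ω {k}).card = -(-1) ^ ω.card := by
      by_cases hω : k ∈ ω
      · rw [show symmDiff ω {k} = ω.erase k by
          ext a; by_cases h : a = k <;> simp [Finset.mem_symmDiff, h, hω],
          ← Finset.card_erase_add_one hω, pow_succ]
        ring
      · rw [show symmDiff ω {k} = insert k ω by
          ext a; by_cases h : a = k <;> simp [Finset.mem_symmDiff, h, hω],
          Finset.card_insert_of_notMem hω, pow_succ]
        ring
    simp only [h₁, h₂]
    ring
  · intro ω _ _ h
    simp at h

theorem topDiff_single_univ : topDiff F N (Pi.single Finset.univ 1) = (-1) ^ N := by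
  rw [topDiff_apply, Finset.sum_eq_single Finset.univ] <;> simp +contextual

end Cube

/-! ### An algebra which looks locally like `P_2` -/

namespace PAlg

open FreeNonUnitalNonAssocAlgebra

variable {F : Type*} [Field F] {n N : ℕ}

/-- The subspace of functions `Ω → P_n` whose coordinate functions lie in prescribed spaces. -/
def coordSubspace {Ω : Type*} (K : PIndex n → Submodule F (Ω → F)) :
    Submodule F (Ω → PAlg F n) where
  carrier := {x | ∀ p, (fun ω => x ω p) ∈ K p}
  zero_mem' p := (K p).zero_mem
  add_mem' hx hy p := (K p).add_mem (hx p) (hy p)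
  smul_mem' r _ hx p := (K p).smul_mem r (hx p)

section Coordinates

variable {Ω : Type*} {K K' K'' : PIndex n → Submodule F (Ω → F)}

/-- A criterion for products of functions into `P_n` in terms of coordinate functions. -/
theorem mul_mem_coordSubspace
    (hd : ∀ i j, ∀ f ∈ K (.a i j), ∀ g ∈ K' (.c i), f * g ∈ K'' (.d i j))
    (he : ∀ i j, ∀ f ∈ K (.b i j), ∀ g ∈ K' (.c i), f * g ∈ K'' (.e i j))
    (hae : ∀ i j, ∀ f ∈ K (.a i j), ∀ g ∈ K' (.e i j), f * g ∈ K'' (.c j))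
    (hea : ∀ i j, ∀ f ∈ K (.e i j), ∀ g ∈ K' (.a i j), f * g ∈ K'' (.c j))
    (hbd : ∀ i j, ∀ f ∈ K (.b i j), ∀ g ∈ K' (.d i j), f * g ∈ K'' (.c j))
    (hdb : ∀ i j, ∀ f ∈ K (.d i j), ∀ g ∈ K' (.b i j), f * g ∈ K'' (.c j))
    {x y : Ω → PAlg F n} (hx : x ∈ coordSubspace K) (hy : y ∈ coordSubspace K') :
    x * y ∈ coordSubspace K'' := by
  intro p
  cases p with
  | a i j => exact (funext fun ω => mul_a (x ω) (y ω) i j : (fun ω => (x * y) ω (.a i j)) = 0) ▸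
    (K'' (.a i j)).zero_mem
  | b i j => exact (funext fun ω => mul_b (x ω) (y ω) i j : (fun ω => (x * y) ω (.b i j)) = 0) ▸
    (K'' (.b i j)).zero_mem
  | c j =>
    have : (fun ω => (x * y) ω (.c j)) =
        ∑ i, ((fun ω => x ω (.a i j)) * (fun ω => y ω (.e i j))
          + (fun ω => x ω (.e i j)) * (fun ω => y ω (.a i j))
          - (fun ω => x ω (.b i j)) * (fun ω => y ω (.d i j))
          - (fun ω => x ω (.d i j)) * (fun ω => y ω (.b i j))) := by
      ext ω
      simp [mul_c]
    rw [this]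
    exact Submodule.sum_mem _ fun i _ => Submodule.sub_mem _ (Submodule.sub_mem _
      (Submodule.add_mem _ (hae i j _ (hx _) _ (hy _)) (hea i j _ (hx _) _ (hy _)))
      (hbd i j _ (hx _) _ (hy _))) (hdb i j _ (hx _) _ (hy _))
  | d i j =>
    rw [show (fun ω => (x * y) ω (.d i j)) = (fun ω => x ω (.a i j)) * fun ω => y ω (.c i) from
      funext fun ω => mul_d (x ω) (y ω) i j]
    exact hd i j _ (hx _) _ (hy _)
  | e i j =>
    rw [show (fun ω => (x * y) ω (.e i j)) = (fun ω => x ω (.b i j)) * fun ω => y ω (.c i) from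
      funext fun ω => mul_e (x ω) (y ω) i j]
    exact he i j _ (hx _) _ (hy _)

end Coordinates

/-- A pair `(i, j)` is an edge of the path `0 → 1 → 2` with a loop at each vertex. -/
def IsEdge (i j : Fin 3) : Prop := i = j ∨ i.val + 1 = j.val

instance (i j : Fin 3) : Decidable (IsEdge i j) := inferInstanceAs (Decidable (_ ∨ _))

variable (F N) in
/-- The coordinate functions on the cube allowed in `pathAlgebra`. The vectors `c_i, d_ij, e_ij` are
said to be located at the vertex `i`. Only edges of the path occur, the loop at the vertex `1` has
coefficients of degree at most `1`, the other edges have constant coefficients, and so have the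
vectors located at the vertex `0`. The conditions on `b_ij`, `e_ij` are literally those on
`a_ij`, `d_ij`, so the lemmas below are stated for the latter only. -/
def pathCoord : PIndex 3 → Submodule F (Finset (Fin N) → F)
  | .a i j | .b i j =>
    if IsEdge i j then if i = 1 ∧ j = 1 then degreeLE F N 1 else degreeLE F N 0 else ⊥
  | .c i => if i = 0 then degreeLE F N 0 else ⊤
  | .d i j | .e i j => if IsEdge i j then if i = 0 then degreeLE F N 0 else ⊤ else ⊥

theorem eq_zero_or_isEdge {i j : Fin 3} {f : Finset (Fin N) → F}
    (hf : f ∈ pathCoord F N (.a i j)) :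
    f = 0 ∨ IsEdge i j ∧ (¬(i = 1 ∧ j = 1) → f ∈ degreeLE F N 0) := by
  change f ∈ if IsEdge i j then if i = 1 ∧ j = 1 then degreeLE F N 1 else degreeLE F N 0 else ⊥
    at hf
  split_ifs at hf with h₁ h₂
  · exact .inr ⟨h₁, fun h => absurd h₂ h⟩
  · exact .inr ⟨h₁, fun _ => hf⟩
  · exact .inl hf

theorem pathCoord_mul_c (i j : Fin 3) (f : Finset (Fin N) → F) (hf : f ∈ pathCoord F N (.a i j))
    (g : Finset (Fin N) → F) (hg : g ∈ pathCoord F N (.c i)) :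
    f * g ∈ pathCoord F N (.d i j) := by
  obtain rfl | ⟨h, hf⟩ := eq_zero_or_isEdge hf
  · rw [zero_mul]
    exact Submodule.zero_mem _
  change f * g ∈ if IsEdge i j then if i = 0 then degreeLE F N 0 else ⊤ else ⊥
  rw [if_pos h]
  split_ifs with hi
  · subst hi
    change g ∈ if (0 : Fin 3) = 0 then degreeLE F N 0 else ⊤ at hg
    rw [if_pos rfl] at hg
    exact mul_mem_degreeLE (m := 0) (n := 0) (hf (by simp)) hg
  · trivial

theorem pathCoord_mul_d (i j : Fin 3) (f : Finset (Fin N) → F) (hf : f ∈ pathCoord F N (.a i j))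
    (g : Finset (Fin N) → F) (hg : g ∈ pathCoord F N (.d i j)) :
    f * g ∈ pathCoord F N (.c j) := by
  obtain rfl | ⟨h, hf⟩ := eq_zero_or_isEdge hf
  · rw [zero_mul]
    exact Submodule.zero_mem _
  change f * g ∈ if j = 0 then degreeLE F N 0 else ⊤
  split_ifs with hj
  · subst hj
    obtain rfl : i = 0 := h.resolve_right (by simp)
    change g ∈ if IsEdge 0 0 then if (0 : Fin 3) = 0 then degreeLE F N 0 else ⊤ else ⊥ at hg
    rw [if_pos h, if_pos rfl] at hg
    exact mul_mem_degreeLE (m := 0) (n := 0) (hf (by simp)) hg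
  · trivial

variable (F N) in
/-- The algebra of functions from the cube `{0, 1}^N` to `P_3` with coordinate functions as
in `pathCoord`. -/
def pathAlgebra : NonUnitalSubalgebra F (Finset (Fin N) → PAlg F 3) where
  __ := coordSubspace (pathCoord F N)
  mul_mem' := mul_mem_coordSubspace pathCoord_mul_c pathCoord_mul_c pathCoord_mul_d
    (fun i j f hf g hg => by rw [mul_comm]; exact pathCoord_mul_d i j g hg f hf) pathCoord_mul_d
    (fun i j f hf g hg => by rw [mul_comm]; exact pathCoord_mul_d i j g hg f hf)

variable (F N) in
/-- The coordinate functions allowed in `pathIdeal`. -/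
def pathIdealCoord : PIndex 3 → Submodule F (Finset (Fin N) → F)
  | .a _ _ | .b _ _ => ⊥
  | .c j | .d _ j | .e _ j => if j = 2 then LinearMap.ker (topDiff F N) else ⊥

variable (F N) in
/-- The functions supported on the vectors `c_2, d_i2, e_i2`, with coordinate functions of
vanishing top difference. It is stable under multiplication by `pathAlgebra` because only constant
coefficients occur on the edges which end at `2`. -/
def pathIdeal : Submodule F (Finset (Fin N) → PAlg F 3) := coordSubspace (pathIdealCoord F N)

theorem pathIdealCoord_mul_c (i j : Fin 3) (f : Finset (Fin N) → F)
    (hf : f ∈ pathCoord F N (.a i j)) (g : Finset (Fin N) → F)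
    (hg : g ∈ pathIdealCoord F N (.c i)) : f * g ∈ pathIdealCoord F N (.d i j) := by
  change g ∈ if i = 2 then LinearMap.ker (topDiff F N) else ⊥ at hg
  split_ifs at hg with hi
  · obtain rfl | ⟨h, hf⟩ := eq_zero_or_isEdge hf
    · rw [zero_mul]
      exact Submodule.zero_mem _
    subst hi
    obtain rfl : 2 = j := h.resolve_right (by simp; omega)
    exact topDiff_const_mul (hf (by simp)) hg
  · rw [show g = 0 from hg, mul_zero]
    exact Submodule.zero_mem _

theorem pathIdealCoord_mul_d (i j : Fin 3) (f : Finset (Fin N) → F)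
    (hf : f ∈ pathCoord F N (.a i j)) (g : Finset (Fin N) → F)
    (hg : g ∈ pathIdealCoord F N (.d i j)) : f * g ∈ pathIdealCoord F N (.c j) := by
  change g ∈ if j = 2 then LinearMap.ker (topDiff F N) else ⊥ at hg
  split_ifs at hg with hj
  · obtain rfl | ⟨-, hf⟩ := eq_zero_or_isEdge hf
    · rw [zero_mul]
      exact Submodule.zero_mem _
    subst hj
    exact topDiff_const_mul (hf (by simp)) hg
  · rw [show g = 0 from hg, mul_zero]
    exact Submodule.zero_mem _

theorem mul_mem_pathIdeal {x y : Finset (Fin N) → PAlg F 3} (hx : x ∈ pathAlgebra F N)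
    (hy : y ∈ pathIdeal F N) : x * y ∈ pathIdeal F N := by
  refine mul_mem_coordSubspace pathIdealCoord_mul_c pathIdealCoord_mul_c pathIdealCoord_mul_d
    (fun i j f _ g hg => ?_) pathIdealCoord_mul_d (fun i j f _ g hg => ?_) hx hy <;>
  · rw [show g = 0 from hg, mul_zero]
    exact Submodule.zero_mem _

theorem mul_mem_pathIdeal_right {x y : Finset (Fin N) → PAlg F 3} (hx : x ∈ pathAlgebra F N)
    (hy : y ∈ pathIdeal F N) : y * x ∈ pathIdeal F N := by
  refine mul_mem_coordSubspace (fun i j f hf g _ => ?_) (fun i j f hf g _ => ?_)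
    (fun i j f hf g _ => ?_)
    (fun i j f hf g hg => by rw [mul_comm]; exact pathIdealCoord_mul_d i j g hg f hf)
    (fun i j f hf g _ => ?_)
    (fun i j f hf g hg => by rw [mul_comm]; exact pathIdealCoord_mul_d i j g hg f hf) hy hx <;>
  · rw [show f = 0 from hf, zero_mul]
    exact Submodule.zero_mem _

end PAlg

namespace PAlg

open FreeNonUnitalNonAssocAlgebra

variable {F : Type*} [Field F] {n N : ℕ}

/-! ### Identities of `P_2` of small degree hold in the path algebra -/

theorem lift_apply {Ω : Type*} (x : ℕ → Ω → PAlg F n) (f : NonassocPoly F) (ω : Ω) :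
    lift F x f ω = lift F (fun i => x i ω) f :=
  map_lift_of_mulOn ⊤ (LinearMap.proj ω : (Ω → PAlg F n) →ₗ[F] PAlg F n) (fun _ _ _ _ => rfl)
    (fun _ => trivial) f

/-- Every polynomial has a degree `D`: its values at points whose coordinates are of degree at most
`1` on a cube have coordinates of degree at most `D`. -/
theorem exists_degree (n : ℕ) (f : NonassocPoly F) :
    ∃ D, ∀ (N : ℕ) (x : ℕ → Finset (Fin N) → PAlg F n),
      (∀ i, x i ∈ coordSubspace fun _ => degreeLE F N 1) →
        lift F x f ∈ coordSubspace fun _ => degreeLE F N D := by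
  induction f using NonassocPoly.induction with
  | zero => exact ⟨0, fun N x _ => by simp⟩
  | of i => exact ⟨1, fun N x hx => by simpa using hx i⟩
  | add f g hf hg =>
    obtain ⟨D, hD⟩ := hf
    obtain ⟨D', hD'⟩ := hg
    refine ⟨max D D', fun N x hx => ?_⟩
    rw [map_add]
    exact add_mem (fun p => degreeLE_mono (le_max_left _ _) (hD N x hx p))
      (fun p => degreeLE_mono (le_max_right _ _) (hD' N x hx p))
  | smul r f hf =>
    obtain ⟨D, hD⟩ := hf
    refine ⟨D, fun N x hx => ?_⟩
    rw [map_smul]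
    exact Submodule.smul_mem _ r (hD N x hx)
  | mul f g hf hg =>
    obtain ⟨D, hD⟩ := hf
    obtain ⟨D', hD'⟩ := hg
    refine ⟨D + D', fun N x hx => ?_⟩
    rw [map_mul]
    refine mul_mem_coordSubspace ?_ ?_ ?_ ?_ ?_ ?_ (hD N x hx) (hD' N x hx) <;>
      exact fun _ _ _ hf _ hg => mul_mem_degreeLE hf hg

/-- The label with vertices renamed by `v`. -/
def relabel {m n : ℕ} (v : Fin m → Fin n) : PIndex m → PIndex n
  | .a i j => .a (v i) (v j)
  | .b i j => .b (v i) (v j)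
  | .c i => .c (v i)
  | .d i j => .d (v i) (v j)
  | .e i j => .e (v i) (v j)

/-- The coordinates of an element of `P_n` with labels in the image of `v`, as an element
of `P_m`. -/
def restrict {m n : ℕ} (v : Fin m → Fin n) : PAlg F n →ₗ[F] PAlg F m where
  toFun x := fun p => x (relabel v p)
  map_add' _ _ := rfl
  map_smul' _ _ := rfl

theorem restrict_apply {m n : ℕ} (v : Fin m → Fin n) (x : PAlg F n) (p : PIndex m) :
    restrict v x p = x (relabel v p) := rfl

variable (F) in
/-- The elements of `P_3` which involve only edges of the path. -/
def edgeSubalgebra : NonUnitalSubalgebra F (PAlg F 3) where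
  carrier := {x | ∀ i j, ¬IsEdge i j →
    x (.a i j) = 0 ∧ x (.b i j) = 0 ∧ x (.d i j) = 0 ∧ x (.e i j) = 0}
  zero_mem' := fun i j _ => by simp
  add_mem' := fun hx hy i j h => by simp [hx i j h, hy i j h]
  smul_mem' := fun r x hx i j h => by simp [hx i j h]
  mul_mem' := fun hx _ i j h => by simp [hx i j h, mul_d, mul_e]

variable (F) in
/-- The elements of `edgeSubalgebra` without components at the vertex `0`. -/
def tailSubalgebra : NonUnitalSubalgebra F (PAlg F 3) where
  carrier := {x | x ∈ edgeSubalgebra F ∧ x (.c 0) = 0 ∧ ∀ j, x (.d 0 j) = 0 ∧ x (.e 0 j) = 0}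
  zero_mem' := ⟨zero_mem _, by simp⟩
  add_mem' := fun hx hy => ⟨add_mem hx.1 hy.1, by simp [hx.2, hy.2]⟩
  smul_mem' := fun r x hx => ⟨SMulMemClass.smul_mem r hx.1, by simp [hx.2]⟩
  mul_mem' := fun {x y} hx hy => by
    refine ⟨mul_mem hx.1 hy.1, ?_, fun j => by simp [mul_d, mul_e, hy.2]⟩
    have h₁ := hx.1 1 0 (by decide)
    have h₂ := hx.1 2 0 (by decide)
    simp [mul_c, Fin.sum_univ_three, hx.2, hy.2, h₁, h₂]

/-- Forgetting the vertex `2` is multiplicative: no edge leads from `2` to another vertex. -/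
theorem restrict_castSucc_mul {x y : PAlg F 3} (hx : x ∈ edgeSubalgebra F)
    (hy : y ∈ edgeSubalgebra F) :
    restrict Fin.castSucc (x * y) = restrict Fin.castSucc x * restrict Fin.castSucc y := by
  ext p
  cases p with
  | c j =>
    have hj : ¬IsEdge 2 j.castSucc := by fin_cases j <;> decide
    obtain ⟨ha, hb, -, -⟩ := hx _ _ hj
    obtain ⟨ha', hb', -, -⟩ := hy _ _ hj
    rw [restrict_apply, relabel, mul_c, mul_c, Fin.sum_univ_castSucc]
    simp [ha, hb, ha', hb', restrict_apply, relabel]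
  | _ => simp [restrict_apply, relabel, mul_d, mul_e]

/-- Forgetting the vertex `0` is multiplicative on elements without components there. -/
theorem restrict_succ_mul {x y : PAlg F 3} (hx : x ∈ tailSubalgebra F)
    (hy : y ∈ tailSubalgebra F) :
    restrict Fin.succ (x * y) = restrict Fin.succ x * restrict Fin.succ y := by
  ext p
  cases p with
  | c j =>
    rw [restrict_apply, relabel, mul_c, mul_c, Fin.sum_univ_succ]
    simp [hx.2, hy.2, restrict_apply, relabel]
  | _ => simp [restrict_apply, relabel, mul_d, mul_e]

/-- Identities of `P_2` have no linear part. -/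
theorem lift_a_b_eq_zero {f : NonassocPoly F} (hf : f ∈ identities F (PAlg F 2))
    (x : ℕ → PAlg F 3) (i j : Fin 3) :
    lift F x f (.a i j) = 0 ∧ lift F x f (.b i j) = 0 := by
  have key (p : PIndex 3) (hp : ∀ y z : PAlg F 3, (y * z) p = 0) : lift F x f p = 0 := by
    -- The span of a basis vector `a_ij` of `P_2` has zero multiplication.
    let φ : PAlg F 3 →ₗ[F] PAlg F 2 :=
      LinearMap.toSpanSingleton F _ (basisVec (.a 0 0)) ∘ₗ
        (LinearMap.proj p : (PIndex 3 → F) →ₗ[F] F)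
    have hφ (y : PAlg F 3) : φ y = y p • basisVec (.a 0 0) := rfl
    have h := map_lift_of_mulOn ⊤ φ (x := x) (fun y _ z _ => by
      rw [hφ, hφ, hφ, hp, smul_mul_smul_comm, basisVec_mul_basisVec]
      simp [basisMul]) (fun _ => trivial) f
    rw [hf, hφ] at h
    simpa [basisVec_apply] using congrArg (fun z : PAlg F 2 => z (.a 0 0)) h
  exact ⟨key _ fun y z => mul_a y z i j, key _ fun y z => mul_b y z i j⟩

theorem lift_relabel_castSucc {f : NonassocPoly F} (hf : f ∈ identities F (PAlg F 2))
    {x : ℕ → PAlg F 3} (hx : ∀ i, x i ∈ edgeSubalgebra F)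
    (p : PIndex 2) : lift F x f (relabel Fin.castSucc p) = 0 := by
  change restrict Fin.castSucc (lift F x f) p = 0
  rw [map_lift_of_mulOn (edgeSubalgebra F) (restrict Fin.castSucc)
    (fun y hy z hz => restrict_castSucc_mul hy hz) hx, hf, zero_coord]

theorem lift_relabel_succ {f : NonassocPoly F} (hf : f ∈ identities F (PAlg F 2))
    {x : ℕ → PAlg F 3} (hx : ∀ i, x i ∈ tailSubalgebra F)
    (p : PIndex 2) : lift F x f (relabel Fin.succ p) = 0 := by
  change restrict Fin.succ (lift F x f) p = 0
  rw [map_lift_of_mulOn (tailSubalgebra F) (restrict Fin.succ)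
    (fun y hy z hz => restrict_succ_mul hy hz) hx, hf, zero_coord]

/-- The decomposition of `P_3` into three parts: the span of the `a_ij` and `b_ij`, the other
vectors located at the vertex `0`, and the other vectors located elsewhere. -/
def part : PIndex 3 → Fin 3
  | .a _ _ | .b _ _ => 0
  | .c i | .d i _ | .e i _ => if i = 0 then 1 else 2

/-- The component of an element of `P_3` in one of the three parts. -/
def component (k : Fin 3) (x : PAlg F 3) : PAlg F 3 := fun p => if part p = k then x p else 0

theorem component_apply (k : Fin 3) (x : PAlg F 3) (p : PIndex 3) :
    component k x p = if part p = k then x p else 0 := rfl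

theorem component_add_add (x : PAlg F 3) :
    component 0 x + component 1 x + component 2 x = x := by
  ext p
  simp only [add_coord, component_apply]
  generalize part p = k
  fin_cases k <;> simp

theorem component_mem_tailSubalgebra {k : Fin 3} (hk : k ≠ 1) {x : PAlg F 3}
    (hx : x ∈ edgeSubalgebra F) : component k x ∈ tailSubalgebra F := by
  refine ⟨fun i j h => ?_, ?_, fun j => ?_⟩
  · simp [component_apply, hx i j h]
  · simp [component_apply, part, hk.symm]
  · simp [component_apply, part, hk.symm]

/-- The span of the `c_i`, `d_ij`, `e_ij`. -/
def squareSubspace : Submodule F (PAlg F n) where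
  carrier := {x | ∀ i j, x (.a i j) = 0 ∧ x (.b i j) = 0}
  zero_mem' := fun i j => by simp
  add_mem' := fun hx hy i j => by simp [hx i j, hy i j]
  smul_mem' := fun r x hx i j => by simp [hx i j]

theorem mul_eq_zero_of_mem_squareSubspace {x y : PAlg F n} (hx : x ∈ squareSubspace)
    (hy : y ∈ squareSubspace) : x * y = 0 := by
  ext p
  cases p with
  | c j => simp [mul_c, fun i => hx i j, fun i => hy i j]
  | d i j => simp [mul_d, hx i j]
  | e i j => simp [mul_e, hx i j]
  | _ => simp

theorem component_mem_squareSubspace {k : Fin 3} (hk : k ≠ 0) (x : PAlg F 3) :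
    component k x ∈ squareSubspace := fun i j => by simp [component_apply, part, hk.symm]

theorem apply_mem_edgeSubalgebra {x : Finset (Fin N) → PAlg F 3} (hx : x ∈ pathAlgebra F N)
    (ω : Finset (Fin N)) : x ω ∈ edgeSubalgebra F := by
  intro i j h
  have ha : (fun ω => x ω (.a i j)) ∈ if IsEdge i j then _ else _ := hx (.a i j)
  have hb : (fun ω => x ω (.b i j)) ∈ if IsEdge i j then _ else _ := hx (.b i j)
  have hd : (fun ω => x ω (.d i j)) ∈ if IsEdge i j then _ else _ := hx (.d i j)
  have he : (fun ω => x ω (.e i j)) ∈ if IsEdge i j then _ else _ := hx (.e i j)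
  rw [if_neg h] at ha hb hd he
  exact ⟨congrFun ha ω, congrFun hb ω, congrFun hd ω, congrFun he ω⟩

theorem pathCoord_le_degreeLE {p : PIndex 3} (hp : part p ≠ 2) :
    pathCoord F N p ≤ degreeLE F N 1 := by
  have h₀ : degreeLE F N 0 ≤ degreeLE F N 1 := degreeLE_mono zero_le_one
  cases p with
  | a i j | b i j => simp only [pathCoord]; split_ifs <;> simp [h₀]
  | c i | d i j | e i j =>
    have hi : i = 0 := by simpa [part] using hp
    simp only [pathCoord, if_pos hi]
    try split_ifs
    all_goals simp [h₀]

/-- An identity of `P_2` of degree less than `N` takes values in `pathIdeal` on `pathAlgebra`.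
The restrictions to `P_2` control everything except the contribution of components located
at the vertex `0` to components which end at `2`; its coefficients have small degree on the cube. -/
theorem mem_relativeIdentities {f : NonassocPoly F} (hf : f ∈ identities F (PAlg F 2)) {D : ℕ}
    (hD : ∀ (N : ℕ) (x : ℕ → Finset (Fin N) → PAlg F 3),
      (∀ i, x i ∈ coordSubspace fun _ => degreeLE F N 1) →
        lift F x f ∈ coordSubspace fun _ => degreeLE F N D) (hN : D < N) :
    f ∈ relativeIdentities (pathAlgebra F N) (pathIdeal F N) := by
  intro x hx
  have hedge (i ω) : x i ω ∈ edgeSubalgebra F := apply_mem_edgeSubalgebra (hx i) ω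
  have h₀₁ (ω) (q : PIndex 2) : lift F x f ω (relabel Fin.castSucc q) = 0 := by
    rw [lift_apply]
    exact lift_relabel_castSucc hf (fun i => hedge i ω) q
  have h₁₂ (q : PIndex 2) :
      topDiff F N (fun ω => lift F x f ω (relabel Fin.succ q)) = 0 := by
    -- Components located at `1` or `2` do not contribute here, so they are removed from `x`.
    let y : ℕ → Finset (Fin N) → PAlg F 3 := fun i ω => component 0 (x i ω) + component 1 (x i ω)
    have hy (i) : y i ∈ coordSubspace fun _ => degreeLE F N 1 := by
      intro p
      by_cases hp : part p = 2
      · have : (fun ω => y i ω p) = 0 := by ext ω; simp [y, component_apply, hp]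
        rw [this]
        exact Submodule.zero_mem _
      · have : (fun ω => y i ω p) = fun ω => x i ω p := by
          ext ω
          simp only [y, add_coord, component_apply]
          generalize part p = k at hp
          fin_cases k <;> simp at hp ⊢
        rw [this]
        exact pathCoord_le_degreeLE hp (hx i p)
    have hxy : (fun ω => lift F x f ω (relabel Fin.succ q)) =
        fun ω => lift F y f ω (relabel Fin.succ q) := by
      ext ω
      have h := lift_add_add squareSubspace (fun a b i j => ⟨mul_a a b i j, mul_b a b i j⟩)
        (fun a ha b hb => mul_eq_zero_of_mem_squareSubspace ha hb)
        (fun i => component 0 (x i ω)) (fun i => component 1 (x i ω))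
        (fun i => component 2 (x i ω)) (fun i => component_mem_squareSubspace (by simp) _)
        (fun i => component_mem_squareSubspace (by simp) _) f
      have hsum : ((fun i => component 0 (x i ω)) + (fun i => component 1 (x i ω)) +
          fun i => component 2 (x i ω)) = fun i => x i ω :=
        funext fun i => component_add_add _
      rw [hsum] at h
      have h₀ := fun i => component_mem_tailSubalgebra zero_ne_one (hedge i ω)
      have h₂ := fun i => component_mem_tailSubalgebra (k := 2) (by decide) (hedge i ω)
      rw [lift_apply, lift_apply, h, sub_coord, add_coord, lift_relabel_succ hf h₀,
        lift_relabel_succ hf (x := (fun i => component 0 (x i ω)) + fun i => component 2 (x i ω))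
          (fun i => add_mem (h₀ i) (h₂ i)), add_zero, sub_zero]
      rfl
    rw [hxy]
    exact topDiff_eq_zero hN (hD N y hy _)
  have hzero (ω) : lift F x f ω ∈ edgeSubalgebra F :=
    apply_mem_edgeSubalgebra (lift_mem _ hx f) ω
  have hab (ω i j) : lift F x f ω (.a i j) = 0 ∧ lift F x f ω (.b i j) = 0 := by
    rw [lift_apply]
    exact lift_a_b_eq_zero hf _ i j
  have hc (j : Fin 3) : (fun ω => lift F x f ω (.c j)) ∈ pathIdealCoord F N (.c j) :=
    match j with
    | 0 => funext fun ω => h₀₁ ω (.c 0)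
    | 1 => funext fun ω => h₀₁ ω (.c 1)
    | 2 => h₁₂ (.c 1)
  have hd (i j : Fin 3) : (fun ω => lift F x f ω (.d i j)) ∈ pathIdealCoord F N (.d i j) := by
    by_cases h : IsEdge i j
    · exact match i, j, h with
      | 0, 0, _ => funext fun ω => h₀₁ ω (.d 0 0)
      | 0, 1, _ => funext fun ω => h₀₁ ω (.d 0 1)
      | 1, 1, _ => funext fun ω => h₀₁ ω (.d 1 1)
      | 1, 2, _ => h₁₂ (.d 0 1)
      | 2, 2, _ => h₁₂ (.d 1 1)
    · rw [show (fun ω => lift F x f ω (.d i j)) = 0 from funext fun ω => (hzero ω i j h).2.2.1]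
      exact Submodule.zero_mem _
  have he (i j : Fin 3) : (fun ω => lift F x f ω (.e i j)) ∈ pathIdealCoord F N (.e i j) := by
    by_cases h : IsEdge i j
    · exact match i, j, h with
      | 0, 0, _ => funext fun ω => h₀₁ ω (.e 0 0)
      | 0, 1, _ => funext fun ω => h₀₁ ω (.e 0 1)
      | 1, 1, _ => funext fun ω => h₀₁ ω (.e 1 1)
      | 1, 2, _ => h₁₂ (.e 0 1)
      | 2, 2, _ => h₁₂ (.e 1 1)
    · rw [show (fun ω => lift F x f ω (.e i j)) = 0 from funext fun ω => (hzero ω i j h).2.2.2]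
      exact Submodule.zero_mem _
  intro p
  cases p with
  | a i j => exact funext fun ω => (hab ω i j).1
  | b i j => exact funext fun ω => (hab ω i j).2
  | c j => exact hc j
  | d i j => exact hd i j
  | e i j => exact he i j

end PAlg

/-! ### Hall's identity fails in the path algebra -/

namespace PAlg

open FreeNonUnitalNonAssocAlgebra

variable {F : Type*} [Field F] {n N : ℕ}

theorem commMatrix_smul_basisVec {y : PAlg F n} (hy : ∀ i j, y (.a i j) = 0) (r : F)
    (i j : Fin n) :
    commMatrix y (r • basisVec (.a i j)) = Matrix.single j i (y (.b i j) * r) := by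
  ext k l
  simp only [commMatrix, Matrix.of_apply, hy, smul_coord, basisVec_apply, Matrix.single_apply,
    PIndex.a.injEq]
  by_cases h : l = i ∧ k = j
  · obtain ⟨rfl, rfl⟩ := h
    simp
  · simp [h, show ¬(j = k ∧ i = l) from fun h' => h ⟨h'.2.symm, h'.1.symm⟩]

variable (F) in
/-- The sum of the `b_ij` over the edges of the path. -/
def edgeSum : PAlg F 3 :=
  basisVec (.b 0 0) + basisVec (.b 0 1) + basisVec (.b 1 1) + basisVec (.b 1 2) +
    basisVec (.b 2 2)

variable (F) in
/-- A point of the path algebra at which `hallPoly F N` takes a value outside the ideal. -/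
def testPoint (ω : Finset (Fin N)) : ℕ → PAlg F 3
  | 0 => edgeSum F
  | 1 => basisVec (.c 0)
  | 2 => (1 : F) • basisVec (.a 2 2)
  | 3 => (1 : F) • basisVec (.a 1 2)
  | 4 => (1 : F) • basisVec (.a 0 1)
  | 5 => (1 : F) • basisVec (.a 0 0)
  | s + 6 => (if s ∈ ω.image Fin.val then 1 else 0 : F) • basisVec (.a 1 1)

theorem smul_basisVec_mem_pathAlgebra {p : PIndex 3} {f : Finset (Fin N) → F}
    (hf : f ∈ pathCoord F N p) : (fun ω => f ω • basisVec p) ∈ pathAlgebra F N := by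
  intro q
  by_cases h : q = p
  · subst h
    simpa [basisVec_apply] using hf
  · rw [show (fun ω => (f ω • basisVec p : PAlg F 3) q) = 0 by ext ω; simp [basisVec_apply, h]]
    exact Submodule.zero_mem _

theorem basisVec_mem_pathAlgebra {p : PIndex 3} (hp : degreeLE F N 0 ≤ pathCoord F N p) (r : F) :
    (fun _ => r • basisVec p) ∈ pathAlgebra F N :=
  smul_basisVec_mem_pathAlgebra (hp (const_mem_degreeLE r 0))

theorem testPoint_mem (i : ℕ) :
    (fun ω : Finset (Fin N) => testPoint F ω i) ∈ pathAlgebra F N := by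
  have ha {i j : Fin 3} (h : IsEdge i j) : degreeLE F N 0 ≤ pathCoord F N (.a i j) := by
    simp only [pathCoord, if_pos h]
    split_ifs
    exacts [degreeLE_mono zero_le_one, le_rfl]
  have hb {i j : Fin 3} (h : IsEdge i j) :
      (fun _ => basisVec (.b i j)) ∈ pathAlgebra F N := by
    simpa using basisVec_mem_pathAlgebra (p := .b i j) (ha h) 1
  match i with
  | 0 =>
    exact add_mem (add_mem (add_mem (add_mem (hb (by decide)) (hb (by decide)))
      (hb (by decide))) (hb (by decide))) (hb (by decide))
  | 1 =>
    have h : degreeLE F N 0 ≤ pathCoord F N (.c 0) := by simp [pathCoord]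
    have := basisVec_mem_pathAlgebra h 1
    simp only [one_smul] at this
    exact this
  | 2 => exact basisVec_mem_pathAlgebra (ha (i := 2) (j := 2) (by decide)) 1
  | 3 => exact basisVec_mem_pathAlgebra (ha (i := 1) (j := 2) (by decide)) 1
  | 4 => exact basisVec_mem_pathAlgebra (ha (i := 0) (j := 1) (by decide)) 1
  | 5 => exact basisVec_mem_pathAlgebra (ha (i := 0) (j := 0) (by decide)) 1
  | s + 6 =>
    refine smul_basisVec_mem_pathAlgebra ?_
    suffices h : (fun ω : Finset (Fin N) => if s ∈ ω.image Fin.val then 1 else 0 : _ → F) ∈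
        degreeLE F N 1 by simpa [pathCoord, IsEdge] using h
    by_cases hs : s < N
    · refine Submodule.subset_span ⟨{⟨s, hs⟩}, by simp, ?_⟩
      ext ω
      congr 1
      simp only [Finset.mem_image, Finset.singleton_subset_iff, eq_iff_iff]
      exact ⟨fun ⟨k, hk, h⟩ => by rwa [show (⟨s, hs⟩ : Fin N) = k from Fin.ext h.symm],
        fun h => ⟨_, h, rfl⟩⟩
    · have : (fun ω : Finset (Fin N) => if s ∈ ω.image Fin.val then 1 else 0 : _ → F) = 0 := by
        ext ω
        refine if_neg fun h => ?_
        obtain ⟨k, -, rfl⟩ := Finset.mem_image.1 h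
        exact hs k.2
      rw [this]
      exact Submodule.zero_mem _

/-- Among the words of Hall's polynomial only `A B C D Z` and `A B D C Z` describe, read from right
to left, paths from `0` to `2`; they pass `C = K` at the vertices `1` and `0` respectively. -/
theorem hall_single (K : Matrix (Fin 3) (Fin 3) F) :
    hall (Matrix.single 2 2 1) (Matrix.single 2 1 1) K (Matrix.single 1 0 1)
      (Matrix.single 0 0 1) 2 0 = K 1 1 - K 0 0 := by
  simp [hall, Matrix.sub_apply, Matrix.add_apply, Matrix.mul_apply, Fin.sum_univ_three,
    Matrix.single_apply]

theorem hallValue_testPoint (hN : 0 < N) (ω : Finset (Fin N)) :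
    hallValue F N (testPoint F ω) (.c 2) = (Pi.single Finset.univ 1 : Finset (Fin N) → F) ω := by
  have hy (i j) : edgeSum F (.a i j) = 0 := by simp [edgeSum, basisVec_apply]
  have hvec : (fun j => ((testPoint F ω 0 * testPoint F ω 1) * testPoint F ω 5) (.c j)) =
      Pi.single 0 1 := by
    ext j
    fin_cases j <;>
      simp [testPoint, mul_c, mul_d, mul_e, edgeSum, basisVec_apply]
  have hK (l : List (Fin N)) :
      (l.map fun s : Fin N => commMatrix (testPoint F ω 0) (testPoint F ω (s.val + 6))).prod 1 1 =
        (l.map fun s => if s ∈ ω then (1 : F) else 0).prod := by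
    induction l with
    | nil => simp
    | cons s l ih =>
      simp only [List.map_cons, List.prod_cons, ← ih, testPoint]
      rw [commMatrix_smul_basisVec hy]
      simp [edgeSum, basisVec_apply, Fin.val_inj]
  -- The product is not empty, so it starts and ends at the vertex `1`.
  have hK₀ : ((List.finRange N).map fun s : Fin N =>
      commMatrix (testPoint F ω 0) (testPoint F ω (s.val + 6))).prod 0 0 = 0 := by
    obtain ⟨N, rfl⟩ := Nat.exists_eq_add_one.2 hN
    simp only [List.finRange_succ, List.map_cons, List.prod_cons, testPoint]
    rw [commMatrix_smul_basisVec hy]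
    simp
  rw [hallValue_eq, hvec, cVec_c, Matrix.mulVec_single_one, Matrix.col_apply]
  simp only [testPoint] at hK hK₀ ⊢
  rw [commMatrix_smul_basisVec hy, commMatrix_smul_basisVec hy, commMatrix_smul_basisVec hy,
    commMatrix_smul_basisVec hy]
  have hb : edgeSum F (.b 2 2) * 1 = 1 ∧ edgeSum F (.b 1 2) * 1 = 1 ∧
      edgeSum F (.b 0 1) * 1 = 1 ∧ edgeSum F (.b 0 0) * 1 = 1 := by
    simp [edgeSum, basisVec_apply]
  rw [hb.1, hb.2.1, hb.2.2.1, hb.2.2.2, hall_single, hK, hK₀, sub_zero, Pi.single_apply]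
  split_ifs with h
  · simp [h]
  · obtain ⟨s, hs⟩ : ∃ s, s ∉ ω := by
      by_contra! H
      exact h (Finset.eq_univ_iff_forall.2 H)
    exact List.prod_eq_zero (List.mem_map.2 ⟨s, List.mem_finRange s, if_neg hs⟩)

theorem hallPoly_notMem_relativeIdentities (hN : 0 < N) :
    hallPoly F N ∉ relativeIdentities (pathAlgebra F N) (pathIdeal F N) := by
  intro h
  have h' : (fun ω => lift F (fun i ω => testPoint F ω i) (hallPoly F N) ω (.c 2)) ∈
      LinearMap.ker (topDiff F N) := h _ testPoint_mem (.c 2)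
  have : (fun ω => lift F (fun i ω => testPoint F ω i) (hallPoly F N) ω (.c 2)) =
      (Pi.single Finset.univ 1 : Finset (Fin N) → F) := by
    ext ω
    rw [lift_apply, lift_hallPoly]
    exact hallValue_testPoint hN ω
  rw [this, LinearMap.mem_ker, topDiff_single_univ] at h'
  exact pow_ne_zero N (neg_ne_zero.2 one_ne_zero) h'

theorem not_hasFiniteBasisOfIdentities : ¬HasFiniteBasisOfIdentities F (PAlg F 2) := by
  rintro ⟨S, hS, hspan⟩
  choose D hD using exists_degree (F := F) 3
  obtain ⟨M, hM⟩ := (hS.image D).bddAbove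
  have hsub : S ⊆ identities F (PAlg F 2) := by
    rw [← hspan]
    exact fun f hf => (Submodule.mem_sInf).2 fun I hI => hI.2 hf
  have hmem : hallPoly F (M + 1) ∈ tIdealSpan F S := by
    rw [← SetLike.mem_coe, hspan]
    exact hallPoly_mem_identities _
  refine hallPoly_notMem_relativeIdentities (F := F) (N := M + 1) M.succ_pos
    (Submodule.mem_sInf.1 hmem _ ⟨isTIdeal_relativeIdentities _ _
      (fun b hb j hj => mul_mem_pathIdeal hb hj)
      (fun b hb j hj => mul_mem_pathIdeal_right hb hj), fun f hf => ?_⟩)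
  exact mem_relativeIdentities (hsub hf) (hD f)
    (Nat.lt_succ_of_le (hM (Set.mem_image_of_mem D hf)))

end PAlg

end

theorem mainTheorem1 (F : Type*) [Field F] :
    FiniteDimensional F (PAlg F 2) ∧
      IsMetabelianAlg (PAlg F 2) ∧
      IsRightSymmetric (PAlg F 2) ∧
      InVarietyR (PAlg F 2) ∧
      ¬ HasFiniteBasisOfIdentities F (PAlg F 2) :=
  ⟨inferInstanceAs (FiniteDimensional F (PIndex 2 → F)), PAlg.isMetabelianAlg,
    PAlg.isRightSymmetric, PAlg.inVarietyR, PAlg.not_hasFiniteBasisOfIdentities⟩
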